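/- Let $M$ be a smooth compact oriented surface without boundary, smoothly immersed into Euclidean space $\mathbb{E}^3$, with unit normal field $\mathbf n$ induced by the orientation, shape operator $S=-d\mathbf n$, and Levi-Civita connection $\nabla$ of the induced metric. Let $(\kappa_1,\kappa_2)$ be the two principal curvature functions of $M$ (the largest and the smallest eigenvalue of $S$, in either order), and let $$\mathcal K'=\max_{q\in M}\ \max_{v\in T_qM,\ \|v\|=1}\|\nabla_v S(q)\|_{\mathrm{op}} .$$ Let $p\in M$ be non-umbilical, and let $(\mathbf v_1,\mathbf v_2,\mathbf n)$ be a Darboux frame at $p$: $\mathbf v_1,\mathbf v_2\in T_pM$ are unit vectors with $S\mathbf v_i=\kappa_i(p)\,\mathbf v_i$ and $\mathbf v_1\times\mathbf v_2=\mathbf n(p)$. Then $\kappa_1$ is differentiable at $p$; there is a principal curvature line $\gamma$, parametrized by arc length on an interval around $0$, with $\gamma(0)=p$ and $\gamma'(0)=\mathbf v_1$; and for every such ($C^2$) curvature line the signed geodesic curvature $\kappa^g_1=\langle\gamma'',\mathbf n\times\gamma'\rangle$ at $p$ satisfies $$\kappa^g_1=\frac{\nabla_{\mathbf v_2}\kappa_1(p)}{\kappa_1(p)-\kappa_2(p)}\qquad\text{and}\qquad|\kappa^g_1|\le\frac{\mathcal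 K'}{|\kappa_1(p)-\kappa_2(p)|}.$$ -/

import Mathlib

open scoped Manifold ContDiff Topology InnerProductSpace

noncomputable section

/-- Euclidean three-space. -/
abbrev E3 : Type := EuclideanSpace ℝ (Fin 3)

/-- The cross product of Euclidean three-space. -/
def cross3 (u v : E3) : E3 := WithLp.toLp 2 (crossProduct u.ofLp v.ofLp)

/-- A smooth oriented surface without boundary `M` (modelled on the plane, not necessarily compact
or connected), smoothly immersed in Euclidean three-space. The orientation is given by the smooth
unit normal field (Gauss map) that it induces: a basis `v, w` of a tangent plane is positively
oriented when `v × w` is a positive multiple of the normal. -/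
structure OrientedImmersedSurface (M : Type*) [TopologicalSpace M]
    [ChartedSpace (EuclideanSpace ℝ (Fin 2)) M] where
  /-- the immersion -/
  toFun : M → E3
  /-- the unit normal field -/
  normal : M → E3
  smooth_toFun : ContMDiff (𝓡 2) 𝓘(ℝ, E3) ∞ toFun
  injective_mfderiv : ∀ p, Function.Injective (mfderiv (𝓡 2) 𝓘(ℝ, E3) toFun p)
  smooth_normal : ContMDiff (𝓡 2) 𝓘(ℝ, E3) ∞ normal
  norm_normal : ∀ p, ‖normal p‖ = 1
  normal_orthogonal : ∀ (p : M) (u : TangentSpace (𝓡 2) p),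
    ⟪normal p, (mfderiv (𝓡 2) 𝓘(ℝ, E3) toFun p u : E3)⟫_ℝ = 0

namespace OrientedImmersedSurface

variable {M : Type*} [TopologicalSpace M] [ChartedSpace (EuclideanSpace ℝ (Fin 2)) M]
  (surf : OrientedImmersedSurface M)

/-- The tangent plane at `p`, as a linear subspace of Euclidean space: the image of the
differential of the immersion. Its inner product is the first fundamental form. -/
def tangentPlane (p : M) : Submodule ℝ E3 :=
  LinearMap.range (mfderiv (𝓡 2) 𝓘(ℝ, E3) surf.toFun p).toLinearMap

/-- The differential of the immersion identifies the abstract tangent space with the tangent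
plane. -/
def tangentEquiv (p : M) : TangentSpace (𝓡 2) p ≃ₗ[ℝ] surf.tangentPlane p :=
  LinearEquiv.ofInjective (mfderiv (𝓡 2) 𝓘(ℝ, E3) surf.toFun p).toLinearMap (surf.injective_mfderiv p)

/-- The differential at `p` of a map `X` from the surface to a normed space, as a linear map on the
tangent plane: `surf.dirDeriv X p v` is the derivative of `X` at `p` in the direction `v`. -/
def dirDeriv {F : Type*} [NormedAddCommGroup F] [NormedSpace ℝ F] (X : M → F) (p : M) :
    surf.tangentPlane p →L[ℝ] F :=
  (mfderiv (𝓡 2) 𝓘(ℝ, F) X p : EuclideanSpace ℝ (Fin 2) →L[ℝ] F) ∘L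
    LinearMap.toContinuousLinearMap
      ((surf.tangentEquiv p).symm.toLinearMap :
        surf.tangentPlane p →ₗ[ℝ] EuclideanSpace ℝ (Fin 2))

/-- The orthogonal projection of Euclidean space onto the tangent plane. -/
def tangentProj (p : M) : E3 →L[ℝ] surf.tangentPlane p :=
  (surf.tangentPlane p).orthogonalProjectionOnto

/-- The shape (Weingarten) operator `S(p) v = - dn_p(v)`. (The derivative of the unit normal is
tangent to the surface; the projection only fixes the target space.) -/
def shapeOperator (p : M) : surf.tangentPlane p →L[ℝ] surf.tangentPlane p :=
  -(surf.tangentProj p ∘L surf.dirDeriv surf.normal p)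

/-- The covariant derivative at `p` (for the Levi-Civita connection of the first fundamental form)
of a tangent vector field `X`: the tangential part of the Euclidean derivative. -/
def covDeriv (X : ∀ q, surf.tangentPlane q) (p : M) (v : surf.tangentPlane p) : surf.tangentPlane p :=
  surf.tangentProj p (surf.dirDeriv (fun q => (X q : E3)) p v)

/-- A field of endomorphisms of the tangent planes, extended by zero to normal vectors. -/
def extendEnd (A : ∀ q, surf.tangentPlane q →L[ℝ] surf.tangentPlane q) (q : M) : E3 →L[ℝ] E3 :=
  (surf.tangentPlane q).subtypeL ∘L A q ∘L surf.tangentProj q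

/-- The covariant derivative `∇_v A` at `p` of a field `A` of endomorphisms of the tangent planes:
the tangential part of the Euclidean derivative. `covDeriv_apply_eq` below is the Leibniz rule
`∇_v (A X) = (∇_v A) X + A (∇_v X)` that characterizes it. -/
def covDerivEnd (A : ∀ q, surf.tangentPlane q →L[ℝ] surf.tangentPlane q) (p : M)
    (v : surf.tangentPlane p) : surf.tangentPlane p →L[ℝ] surf.tangentPlane p :=
  surf.tangentProj p ∘L (surf.dirDeriv (surf.extendEnd A) p v) ∘L (surf.tangentPlane p).subtypeL

theorem covDeriv_apply_eq (A : ∀ q, surf.tangentPlane q →L[ℝ] surf.tangentPlane q)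
    (X : ∀ q, surf.tangentPlane q) (p : M) (v : surf.tangentPlane p)
    (hA : MDifferentiableAt (𝓡 2) 𝓘(ℝ, E3 →L[ℝ] E3) (surf.extendEnd A) p)
    (hX : MDifferentiableAt (𝓡 2) 𝓘(ℝ, E3) (fun q => (X q : E3)) p) :
    surf.covDeriv (fun q => A q (X q)) p v
      = surf.covDerivEnd A p v (X p) + A p (surf.covDeriv X p v) := by
  have hproj : ∀ q (w : surf.tangentPlane q), surf.tangentProj q (w : E3) = w := fun q w =>
    Submodule.orthogonalProjectionOnto_mem_subspace_eq_self w
  have hfun : (fun q => ((A q (X q) : surf.tangentPlane q) : E3))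
      = fun q => surf.extendEnd A q (X q : E3) := by
    funext q
    simp [extendEnd, hproj]
  have h2 := HasFDerivWithinAt.clm_apply hA.hasMFDerivAt.2 hX.hasMFDerivAt.2
  have hc : HasMFDerivAt (𝓡 2) 𝓘(ℝ, E3) (fun q => surf.extendEnd A q (X q : E3)) p _ :=
    ⟨(hA.clm_apply hX).continuousAt, h2⟩
  let dA : EuclideanSpace ℝ (Fin 2) →L[ℝ] (E3 →L[ℝ] E3) :=
    mfderiv (𝓡 2) 𝓘(ℝ, E3 →L[ℝ] E3) (surf.extendEnd A) p
  let dX : EuclideanSpace ℝ (Fin 2) →L[ℝ] E3 :=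
    mfderiv (𝓡 2) 𝓘(ℝ, E3) (fun q => (X q : E3)) p
  let dAX : EuclideanSpace ℝ (Fin 2) →L[ℝ] E3 :=
    mfderiv (𝓡 2) 𝓘(ℝ, E3) (fun q => surf.extendEnd A q (X q : E3)) p
  have hd : ∀ u, dAX u = dA u (X p : E3) + surf.extendEnd A p (dX u) := by
    intro u
    have h1 : dAX = _ := hc.mfderiv
    have h0 : (extChartAt (𝓡 2) p).symm (extChartAt (𝓡 2) p p) = p := extChartAt_to_inv p
    have e1 : writtenInExtChartAt (𝓡 2) 𝓘(ℝ, E3 →L[ℝ] E3) p (surf.extendEnd A)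
        (extChartAt (𝓡 2) p p) = surf.extendEnd A p := congrArg (surf.extendEnd A) h0
    have e2 : writtenInExtChartAt (𝓡 2) 𝓘(ℝ, E3) p (fun q => (X q : E3))
        (extChartAt (𝓡 2) p p) = X p := congrArg (fun q => (X q : E3)) h0
    rw [h1, e1, e2]
    exact add_comm _ _
  have hd' : surf.dirDeriv (fun q => ((A q (X q) : surf.tangentPlane q) : E3)) p v
      = surf.dirDeriv (surf.extendEnd A) p v (X p : E3)
        + surf.extendEnd A p (surf.dirDeriv (fun q => (X q : E3)) p v) := by
    rw [hfun]
    exact hd ((surf.tangentEquiv p).symm v)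
  unfold covDeriv covDerivEnd
  rw [hd', map_add]
  congr 1
  simp only [extendEnd, ContinuousLinearMap.comp_apply, Submodule.subtypeL_apply, hproj]

/-- A point is umbilical if the shape operator is a multiple of the identity there. -/
def IsUmbilical (p : M) : Prop :=
  ∃ c : ℝ, ∀ v : surf.tangentPlane p, surf.shapeOperator p v = c • v

/-- The larger principal curvature at `p`: the largest eigenvalue of the shape operator. -/
def maxPrincipalCurvature (p : M) : ℝ :=
  sSup {c : ℝ | Module.End.HasEigenvalue (surf.shapeOperator p).toLinearMap c}

/-- The smaller principal curvature at `p`: the smallest eigenvalue of the shape operator. -/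
def minPrincipalCurvature (p : M) : ℝ :=
  sInf {c : ℝ | Module.End.HasEigenvalue (surf.shapeOperator p).toLinearMap c}

/-- `κ₁, κ₂` are the two principal curvature functions, in one of the two possible orders. -/
def ArePrincipalCurvatures (κ₁ κ₂ : M → ℝ) : Prop :=
  (κ₁ = surf.maxPrincipalCurvature ∧ κ₂ = surf.minPrincipalCurvature) ∨
    (κ₁ = surf.minPrincipalCurvature ∧ κ₂ = surf.maxPrincipalCurvature)

/-- `v₁, v₂, n = v₁ × v₂` is a Darboux frame at `p`: the `vᵢ` are unit vectors in the principal
directions of `κᵢ`, and `v₁ × v₂` is the normal given by the orientation. -/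
structure IsDarbouxFrame (κ₁ κ₂ : M → ℝ) (p : M) (v₁ v₂ : surf.tangentPlane p) : Prop where
  norm_fst : ‖v₁‖ = 1
  norm_snd : ‖v₂‖ = 1
  shape_fst : surf.shapeOperator p v₁ = κ₁ p • v₁
  shape_snd : surf.shapeOperator p v₂ = κ₂ p • v₂
  cross_eq : cross3 v₁ v₂ = surf.normal p

/-- The velocity, in Euclidean space, of a curve on the surface. -/
def velocity (γ : ℝ → M) (t : ℝ) : E3 := deriv (fun s => surf.toFun (γ s)) t

/-- `γ` is, on the open interval `(a, b)`, a principal curvature line parametrized by arc length: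
a curve of class `C²` on the surface with unit velocity, everywhere in a principal direction. -/
structure IsCurvatureLineOn (γ : ℝ → M) (a b : ℝ) : Prop where
  contMDiffOn : ContMDiffOn 𝓘(ℝ, ℝ) (𝓡 2) 2 γ (Set.Ioo a b)
  norm_velocity : ∀ t ∈ Set.Ioo a b, ‖surf.velocity γ t‖ = 1
  principal : ∀ t ∈ Set.Ioo a b, ∃ v : surf.tangentPlane (γ t), (v : E3) = surf.velocity γ t ∧
    ∃ c : ℝ, surf.shapeOperator (γ t) v = c • v

/-- The (signed) geodesic curvature at time `t` of a curve `γ` parametrized by arc length: the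
component of the acceleration along `n × γ'`, the tangential unit normal of the curve. -/
def geodesicCurvature (γ : ℝ → M) (t : ℝ) : ℝ :=
  ⟪deriv (surf.velocity γ) t, cross3 (surf.normal (γ t)) (surf.velocity γ t)⟫_ℝ

/-- The bound `𝒦'`, the maximum over all points `p` and all unit tangent vectors `v` at `p` of the
operator norm of `∇_v S(p)`. -/
def shapeDerivBound : ℝ :=
  sSup {r : ℝ | ∃ (p : M) (v : surf.tangentPlane p),
    ‖v‖ = 1 ∧ r = ‖surf.covDerivEnd surf.shapeOperator p v‖}

end OrientedImmersedSurface

end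

noncomputable section

namespace OrientedImmersedSurface

variable {M : Type*} [TopologicalSpace M] [ChartedSpace (EuclideanSpace ℝ (Fin 2)) M]
  (surf : OrientedImmersedSurface M)

/-! Everything is computed in Euclidean space with B = `extShape`, the shape operator extended by
zero to normal vectors. B is a smooth map into the fixed space of endomorphisms of `E3`, so it can
be differentiated without a connection. Its derivative D B has two symmetries: D_v B is
self-adjoint, and (D_v B) w = (D_w B) v for tangent v, w (Codazzi, `dirDeriv_extShape_symm`). Let T
be the velocity of a curvature line with T = v₁ at p. Differentiating BT = ⟨BT, T⟩ T and pairing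
with v₂ gives (κ₁ - κ₂) κ^g = ⟨(D_{v₁} B) v₁, v₂⟩ (`geodesicCurvature_mul`). Differentiating BW = κ₁
W for a smooth principal field W through v₁ and pairing with v₁ gives dκ₁(v) = ⟨(D_v B) v₁, v₁⟩
(`dirDeriv_principalCurvature`). The two symmetries identify the first right-hand side with the
second at v = v₂, and the operator norm of ∇_{v₂} S bounds the latter. The field W is (S - κ₂)
applied to the tangential projection of a constant vector; by Cayley–Hamilton it is principal for
κ₁, and it is smooth wherever κ₂ is. Normalized and read in a chart, it is integrated to obtain the
curvature line. -/

instance fact_finrank_E3 : Fact (Module.finrank ℝ E3 = 2 + 1) := ⟨by simp⟩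

/-! ### Tangent planes and the tangential projection. -/

theorem normal_ne_zero (p : M) : surf.normal p ≠ 0 := by
  intro h
  have := surf.norm_normal p
  simp [h] at this

theorem inner_normal_normal (p : M) : ⟪surf.normal p, surf.normal p⟫_ℝ = 1 := by
  rw [real_inner_self_eq_norm_sq, surf.norm_normal, one_pow]

theorem finrank_tangentPlane (p : M) : Module.finrank ℝ (surf.tangentPlane p) = 2 := by
  rw [← (surf.tangentEquiv p).finrank_eq]
  change Module.finrank ℝ (EuclideanSpace ℝ (Fin 2)) = 2
  simp

theorem tangentPlane_eq (p : M) : surf.tangentPlane p = (ℝ ∙ surf.normal p)ᗮ := by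
  apply Submodule.eq_of_le_of_finrank_eq
  · rintro v ⟨u, rfl⟩
    rw [Submodule.mem_orthogonal_singleton_iff_inner_right]
    exact surf.normal_orthogonal p u
  · rw [surf.finrank_tangentPlane,
      Submodule.finrank_orthogonal_span_singleton (n := 2) (surf.normal_ne_zero p)]

theorem mem_tangentPlane_iff {p : M} {v : E3} :
    v ∈ surf.tangentPlane p ↔ ⟪surf.normal p, v⟫_ℝ = 0 := by
  rw [surf.tangentPlane_eq, Submodule.mem_orthogonal_singleton_iff_inner_right]

theorem inner_normal_coe {p : M} (v : surf.tangentPlane p) : ⟪surf.normal p, (v : E3)⟫_ℝ = 0 :=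
  surf.mem_tangentPlane_iff.1 v.2

theorem tangentProj_coe {p : M} (v : surf.tangentPlane p) : surf.tangentProj p (v : E3) = v :=
  Submodule.orthogonalProjectionOnto_mem_subspace_eq_self v

theorem coe_tangentProj (p : M) (v : E3) :
    (surf.tangentProj p v : E3) = v - ⟪surf.normal p, v⟫_ℝ • surf.normal p := by
  have h1 : (⟪surf.normal p, v⟫_ℝ • surf.normal p : E3) ∈ (surf.tangentPlane p)ᗮ := by
    rw [surf.tangentPlane_eq, Submodule.orthogonal_orthogonal]
    exact Submodule.smul_mem _ _ (Submodule.mem_span_singleton_self _)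
  have h2 : v - ⟪surf.normal p, v⟫_ℝ • surf.normal p ∈ surf.tangentPlane p := by
    rw [surf.mem_tangentPlane_iff, inner_sub_right, inner_smul_right, surf.inner_normal_normal]
    ring
  have h3 : surf.tangentProj p v = surf.tangentProj p (v - ⟪surf.normal p, v⟫_ℝ • surf.normal p) := by
    rw [map_sub]
    have : surf.tangentProj p (⟪surf.normal p, v⟫_ℝ • surf.normal p) = 0 :=
      Submodule.orthogonalProjectionOnto_apply_of_mem_orthogonal h1
    rw [this, sub_zero]
  rw [h3]
  exact congrArg Subtype.val (surf.tangentProj_coe ⟨_, h2⟩)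

theorem inner_coe_tangentProj {p : M} (v : surf.tangentPlane p) (w : E3) :
    ⟪(v : E3), (surf.tangentProj p w : E3)⟫_ℝ = ⟪(v : E3), w⟫_ℝ := by
  rw [coe_tangentProj, inner_sub_right, inner_smul_right, real_inner_comm (surf.normal p) (v : E3),
    surf.inner_normal_coe, mul_zero, sub_zero]

/-- The directional derivative computed from an abstract tangent vector. -/
theorem dirDeriv_apply {F : Type*} [NormedAddCommGroup F] [NormedSpace ℝ F] (X : M → F) {p : M}
    {v : surf.tangentPlane p} {w : TangentSpace (𝓡 2) p}
    (h : (v : E3) = mfderiv (𝓡 2) 𝓘(ℝ, E3) surf.toFun p w) :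
    surf.dirDeriv X p v = mfderiv (𝓡 2) 𝓘(ℝ, F) X p w := by
  have : (surf.tangentEquiv p).symm v = w := by
    rw [LinearEquiv.symm_apply_eq]
    exact Subtype.ext h
  change mfderiv (𝓡 2) 𝓘(ℝ, F) X p ((surf.tangentEquiv p).symm v) = _
  rw [this]

/-! ### Calculus in a chart. -/

section Chart

/-- The inverse of the chart at `p`. -/
abbrev param (p : M) : EuclideanSpace ℝ (Fin 2) → M := (extChartAt (𝓡 2) p).symm

/-- The domain of the parametrization `param p`. -/
abbrev paramDomain (p : M) : Set (EuclideanSpace ℝ (Fin 2)) := (extChartAt (𝓡 2) p).target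

/-- Every point is in the range of a parametrization. -/
theorem param_extChartAt (p : M) : param p (extChartAt (𝓡 2) p p) = p := extChartAt_to_inv p

theorem isOpen_paramDomain (p : M) : IsOpen (paramDomain p) := isOpen_extChartAt_target p

/-- The derivative of the parametrization, completed by the normal. -/
def frameMap (p : M) (x : EuclideanSpace ℝ (Fin 2)) : EuclideanSpace ℝ (Fin 2) × ℝ →L[ℝ] E3 :=
  (fderiv ℝ (surf.toFun ∘ param p) x) ∘L ContinuousLinearMap.fst ℝ _ ℝ
    + (ContinuousLinearMap.snd ℝ _ ℝ).smulRight (surf.normal (param p x))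

@[simp] theorem frameMap_apply (p : M) (x : EuclideanSpace ℝ (Fin 2))
    (u : EuclideanSpace ℝ (Fin 2) × ℝ) :
    surf.frameMap p x u
      = fderiv ℝ (surf.toFun ∘ param p) x u.1 + u.2 • surf.normal (param p x) := by
  simp [frameMap]

variable [IsManifold (𝓡 2) ∞ M]

theorem contMDiffOn_param (p : M) :
    ContMDiffOn 𝓘(ℝ, EuclideanSpace ℝ (Fin 2)) (𝓡 2) ∞ (param p) (paramDomain p) :=
  contMDiffOn_extChartAt_symm p

theorem contMDiffAt_param {p : M} {x : EuclideanSpace ℝ (Fin 2)} (hx : x ∈ paramDomain p) :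
    ContMDiffAt 𝓘(ℝ, EuclideanSpace ℝ (Fin 2)) (𝓡 2) ∞ (param p) x :=
  (contMDiffOn_param p).contMDiffAt ((isOpen_paramDomain p).mem_nhds hx)

theorem mdifferentiableAt_param {p : M} {x : EuclideanSpace ℝ (Fin 2)} (hx : x ∈ paramDomain p) :
    MDifferentiableAt 𝓘(ℝ, EuclideanSpace ℝ (Fin 2)) (𝓡 2) (param p) x :=
  (contMDiffAt_param hx).mdifferentiableAt (by simp)

theorem isInvertible_mfderiv_param {p : M} {x : EuclideanSpace ℝ (Fin 2)}
    (hx : x ∈ paramDomain p) :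
    (mfderiv 𝓘(ℝ, EuclideanSpace ℝ (Fin 2)) (𝓡 2) (param p) x).IsInvertible := by
  have : IsManifold (𝓡 2) 1 M := IsManifold.of_le (n := ∞) (by simp)
  have h := isInvertible_mfderivWithin_extChartAt_symm (I := 𝓡 2) hx
  rwa [ModelWithCorners.range_eq_univ, mfderivWithin_univ] at h

theorem contDiffOn_comp_param {F : Type*} [NormedAddCommGroup F] [NormedSpace ℝ F] {X : M → F}
    (hX : ContMDiff (𝓡 2) 𝓘(ℝ, F) ∞ X) (p : M) :
    ContDiffOn ℝ ∞ (X ∘ param p) (paramDomain p) :=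
  contMDiffOn_iff_contDiffOn.1 (hX.comp_contMDiffOn (contMDiffOn_param p))

theorem fderiv_comp_param {F : Type*} [NormedAddCommGroup F] [NormedSpace ℝ F] {X : M → F}
    {p : M} {x : EuclideanSpace ℝ (Fin 2)} (hx : x ∈ paramDomain p)
    (hX : MDifferentiableAt (𝓡 2) 𝓘(ℝ, F) X (param p x)) (u : EuclideanSpace ℝ (Fin 2)) :
    fderiv ℝ (X ∘ param p) x u = mfderiv (𝓡 2) 𝓘(ℝ, F) X (param p x)
      (mfderiv 𝓘(ℝ, EuclideanSpace ℝ (Fin 2)) (𝓡 2) (param p) x u) := by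
  rw [← mfderiv_eq_fderiv, mfderiv_comp x hX (mdifferentiableAt_param hx)]
  rfl

theorem dirDeriv_eq_fderiv {F : Type*} [NormedAddCommGroup F] [NormedSpace ℝ F] {X : M → F}
    {p : M} {x : EuclideanSpace ℝ (Fin 2)} (hx : x ∈ paramDomain p)
    (hX : MDifferentiableAt (𝓡 2) 𝓘(ℝ, F) X (param p x)) {v : surf.tangentPlane (param p x)}
    {u : EuclideanSpace ℝ (Fin 2)} (h : (v : E3) = fderiv ℝ (surf.toFun ∘ param p) x u) :
    surf.dirDeriv X (param p x) v = fderiv ℝ (X ∘ param p) x u := by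
  rw [fderiv_comp_param hx hX]
  apply surf.dirDeriv_apply
  rw [h, fderiv_comp_param hx (surf.smooth_toFun.mdifferentiableAt (by simp))]

theorem mem_tangentPlane_param_iff {p : M} {x : EuclideanSpace ℝ (Fin 2)}
    (hx : x ∈ paramDomain p) {v : E3} :
    v ∈ surf.tangentPlane (param p x) ↔ ∃ u, fderiv ℝ (surf.toFun ∘ param p) x u = v := by
  have hf : MDifferentiableAt (𝓡 2) 𝓘(ℝ, E3) surf.toFun (param p x) :=
    surf.smooth_toFun.mdifferentiableAt (by simp)
  constructor
  · rintro ⟨w, rfl⟩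
    obtain ⟨u : EuclideanSpace ℝ (Fin 2), hu⟩ := (isInvertible_mfderiv_param hx).bijective.2 w
    exact ⟨u, by rw [fderiv_comp_param hx hf, hu]; rfl⟩
  · rintro ⟨u, rfl⟩
    rw [fderiv_comp_param hx hf]
    exact ⟨_, rfl⟩

theorem fderiv_param_injective {p : M} {x : EuclideanSpace ℝ (Fin 2)} (hx : x ∈ paramDomain p) :
    Function.Injective (fderiv ℝ (surf.toFun ∘ param p) x) := by
  have hf : MDifferentiableAt (𝓡 2) 𝓘(ℝ, E3) surf.toFun (param p x) :=
    surf.smooth_toFun.mdifferentiableAt (by simp)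
  intro u w h
  rw [fderiv_comp_param hx hf, fderiv_comp_param hx hf] at h
  exact (isInvertible_mfderiv_param hx).bijective.1 (surf.injective_mfderiv _ h)

theorem inner_normal_fderiv_normal {p : M} {x : EuclideanSpace ℝ (Fin 2)}
    (hx : x ∈ paramDomain p) (u : EuclideanSpace ℝ (Fin 2)) :
    ⟪surf.normal (param p x), fderiv ℝ (surf.normal ∘ param p) x u⟫_ℝ = 0 := by
  have hd : DifferentiableAt ℝ (surf.normal ∘ param p) x :=
    ((contDiffOn_comp_param surf.smooth_normal p).contDiffAt
      ((isOpen_paramDomain p).mem_nhds hx)).differentiableAt (by simp)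
  have h1 : fderiv ℝ (fun y => ⟪(surf.normal ∘ param p) y, (surf.normal ∘ param p) y⟫_ℝ) x u = 0 := by
    have : (fun y => ⟪(surf.normal ∘ param p) y, (surf.normal ∘ param p) y⟫_ℝ) = fun _ => 1 := by
      funext y
      exact surf.inner_normal_normal _
    rw [this]
    simp
  rw [fderiv_inner_apply ℝ hd hd, real_inner_comm ((surf.normal ∘ param p) x)] at h1
  have h2 : ⟪surf.normal (param p x), fderiv ℝ (surf.normal ∘ param p) x u⟫_ℝ
    + ⟪surf.normal (param p x), fderiv ℝ (surf.normal ∘ param p) x u⟫_ℝ = 0 := h1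
  linarith

theorem inner_normal_fderiv_toFun {p : M} {x : EuclideanSpace ℝ (Fin 2)}
    (hx : x ∈ paramDomain p) (u : EuclideanSpace ℝ (Fin 2)) :
    ⟪surf.normal (param p x), fderiv ℝ (surf.toFun ∘ param p) x u⟫_ℝ = 0 :=
  surf.mem_tangentPlane_iff.1 ((surf.mem_tangentPlane_param_iff hx).2 ⟨u, rfl⟩)

/-- The normal is a unit vector orthogonal to the injective image of the differential, and
dimensions agree. The first component of the inverse is then a left inverse of the differential,
depending smoothly on the point and defined on all of `E3`. -/
theorem isInvertible_frameMap {p : M} {x : EuclideanSpace ℝ (Fin 2)} (hx : x ∈ paramDomain p) :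
    (surf.frameMap p x).IsInvertible := by
  have hinj : Function.Injective (surf.frameMap p x).toLinearMap := by
    rw [← LinearMap.ker_eq_bot, LinearMap.ker_eq_bot']
    rintro ⟨u, t⟩ h
    have h' : fderiv ℝ (surf.toFun ∘ param p) x u + t • surf.normal (param p x) = 0 := by
      simpa using h
    have ht : t = 0 := by
      have := congrArg (fun w => ⟪surf.normal (param p x), w⟫_ℝ) h'
      simpa [inner_add_right, inner_smul_right, surf.inner_normal_fderiv_toFun hx,
        surf.inner_normal_normal, surf.norm_normal] using this
    subst ht
    have hu : u = 0 := surf.fderiv_param_injective hx (by simpa using h')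
    rw [hu]
    rfl
  have hdim : Module.finrank ℝ (EuclideanSpace ℝ (Fin 2) × ℝ) = Module.finrank ℝ E3 := by simp
  exact ⟨(LinearEquiv.ofInjectiveOfFinrankEq _ hinj hdim).toContinuousLinearEquiv, by ext <;> rfl⟩

theorem contDiffOn_frameMap (p : M) : ContDiffOn ℝ ∞ (surf.frameMap p) (paramDomain p) := by
  have h1 : ContDiffOn ℝ ∞ (fderiv ℝ (surf.toFun ∘ param p)) (paramDomain p) :=
    (contDiffOn_comp_param surf.smooth_toFun p).fderiv_of_isOpen (isOpen_paramDomain p) (by simp)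
  have h2 := contDiffOn_comp_param surf.smooth_normal p
  exact (h1.clm_comp contDiffOn_const).add (contDiffOn_const.smulRight h2)

theorem contDiffOn_frameMap_inverse (p : M) :
    ContDiffOn ℝ ∞ (fun x => (surf.frameMap p x).inverse) (paramDomain p) := fun x hx =>
  ((surf.isInvertible_frameMap hx).contDiffAt_map_inverse.comp x
    ((surf.contDiffOn_frameMap p).contDiffAt
      ((isOpen_paramDomain p).mem_nhds hx))).contDiffWithinAt

end Chart

/-! ### The extended shape operator: smoothness, symmetry, Codazzi. -/

theorem extendEnd_coe (A : ∀ q, surf.tangentPlane q →L[ℝ] surf.tangentPlane q) {q : M}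
    (v : surf.tangentPlane q) : surf.extendEnd A q (v : E3) = A q v := by
  simp [extendEnd, tangentProj_coe]

theorem tangentProj_normal (q : M) : surf.tangentProj q (surf.normal q) = 0 := by
  ext1
  rw [coe_tangentProj, surf.inner_normal_normal]
  simp

theorem extendEnd_normal (A : ∀ q, surf.tangentPlane q →L[ℝ] surf.tangentPlane q) (q : M) :
    surf.extendEnd A q (surf.normal q) = 0 := by
  simp [extendEnd, tangentProj_normal]

theorem extendEnd_mem (A : ∀ q, surf.tangentPlane q →L[ℝ] surf.tangentPlane q) (q : M) (v : E3) :
    surf.extendEnd A q v ∈ surf.tangentPlane q := by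
  simp [extendEnd]

/-- The shape operator, extended by zero to normal vectors. -/
abbrev extShape : M → (E3 →L[ℝ] E3) := surf.extendEnd surf.shapeOperator

section Manifold

variable [IsManifold (𝓡 2) ∞ M]

theorem fderiv_frameMap_inverse {p : M} {x : EuclideanSpace ℝ (Fin 2)} (hx : x ∈ paramDomain p)
    {v : E3} (hv : v ∈ surf.tangentPlane (param p x)) :
    fderiv ℝ (surf.toFun ∘ param p) x ((surf.frameMap p x).inverse v).1 = v := by
  obtain ⟨u, rfl⟩ := (surf.mem_tangentPlane_param_iff hx).1 hv
  have h : surf.frameMap p x (u, 0) = fderiv ℝ (surf.toFun ∘ param p) x u := by simp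
  rw [← h]
  obtain ⟨e, he⟩ := surf.isInvertible_frameMap hx
  rw [← he, ContinuousLinearMap.inverse_equiv]
  simp only [ContinuousLinearEquiv.coe_coe, ContinuousLinearEquiv.symm_apply_apply]
  rw [← h, ← he]
  rfl

/-- The derivative of a unit field is orthogonal to the field, so the projection in `shapeOperator`
changes nothing. -/
theorem extShape_fderiv {p : M} {x : EuclideanSpace ℝ (Fin 2)} (hx : x ∈ paramDomain p)
    (u : EuclideanSpace ℝ (Fin 2)) :
    surf.extShape (param p x) (fderiv ℝ (surf.toFun ∘ param p) x u)
      = -fderiv ℝ (surf.normal ∘ param p) x u := by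
  let v : surf.tangentPlane (param p x) :=
    ⟨_, (surf.mem_tangentPlane_param_iff hx).2 ⟨u, rfl⟩⟩
  have h1 : surf.dirDeriv surf.normal (param p x) v = fderiv ℝ (surf.normal ∘ param p) x u :=
    surf.dirDeriv_eq_fderiv hx (surf.smooth_normal.mdifferentiableAt (by simp)) rfl
  change surf.extShape (param p x) (v : E3) = _
  rw [extShape, extendEnd_coe, shapeOperator, neg_apply, ContinuousLinearMap.comp_apply, h1,
    Submodule.coe_neg, coe_tangentProj, surf.inner_normal_fderiv_normal hx]
  simp

/-- Only maps between fixed vector spaces occur on the right, so smoothness can be read off. -/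
theorem extShape_param_eq {p : M} {x : EuclideanSpace ℝ (Fin 2)} (hx : x ∈ paramDomain p) :
    surf.extShape (param p x) = (-fderiv ℝ (surf.normal ∘ param p) x) ∘L
      (ContinuousLinearMap.fst ℝ _ ℝ ∘L (surf.frameMap p x).inverse) := by
  ext1 v
  obtain ⟨e, he⟩ := surf.isInvertible_frameMap hx
  obtain ⟨⟨u, t⟩, rfl⟩ := e.surjective v
  have h : e (u, t) = fderiv ℝ (surf.toFun ∘ param p) x u + t • surf.normal (param p x) := by
    rw [← surf.frameMap_apply p x (u, t), ← he]
    rfl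
  rw [← he, ContinuousLinearMap.inverse_equiv]
  nth_rw 1 [h]
  rw [map_add, map_smul, surf.extShape_fderiv hx, extShape, extendEnd_normal]
  simp

theorem contDiffOn_extShape_param (p : M) :
    ContDiffOn ℝ ∞ (surf.extShape ∘ param p) (paramDomain p) := by
  have h1 : ContDiffOn ℝ ∞ (fderiv ℝ (surf.normal ∘ param p)) (paramDomain p) :=
    (contDiffOn_comp_param surf.smooth_normal p).fderiv_of_isOpen (isOpen_paramDomain p) (by simp)
  exact (h1.neg.clm_comp (contDiffOn_const.clm_comp (surf.contDiffOn_frameMap_inverse p))).congr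
    fun x hx => surf.extShape_param_eq hx

theorem contMDiff_extShape : ContMDiff (𝓡 2) 𝓘(ℝ, E3 →L[ℝ] E3) ∞ surf.extShape := by
  intro p
  have h1 : ContMDiffAt (𝓡 2) 𝓘(ℝ, E3 →L[ℝ] E3) ∞
      ((surf.extShape ∘ param p) ∘ extChartAt (𝓡 2) p) p := by
    refine ContMDiffAt.comp p ?_ contMDiffAt_extChartAt
    exact ((surf.contDiffOn_extShape_param p).contDiffAt
      ((isOpen_paramDomain p).mem_nhds (mem_extChartAt_target p))).contMDiffAt
  refine h1.congr_of_eventuallyEq ?_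
  filter_upwards [extChartAt_source_mem_nhds (I := 𝓡 2) p] with q hq
  exact congrArg surf.extShape ((extChartAt (𝓡 2) p).left_inv hq).symm

theorem mdifferentiableAt_extShape (p : M) :
    MDifferentiableAt (𝓡 2) 𝓘(ℝ, E3 →L[ℝ] E3) surf.extShape p :=
  surf.contMDiff_extShape.mdifferentiableAt (by simp)

/-- The second fundamental form is symmetric. -/
theorem inner_fderiv_normal_symm {p : M} {x : EuclideanSpace ℝ (Fin 2)} (hx : x ∈ paramDomain p)
    (u w : EuclideanSpace ℝ (Fin 2)) :
    ⟪fderiv ℝ (surf.normal ∘ param p) x u, fderiv ℝ (surf.toFun ∘ param p) x w⟫_ℝ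
      = ⟪fderiv ℝ (surf.normal ∘ param p) x w, fderiv ℝ (surf.toFun ∘ param p) x u⟫_ℝ := by
  have hn := (isOpen_paramDomain p).mem_nhds hx
  have hF := (contDiffOn_comp_param surf.smooth_toFun p).contDiffAt hn
  have hN := ((contDiffOn_comp_param surf.smooth_normal p).contDiffAt hn).differentiableAt
    (by simp)
  have hdF : DifferentiableAt ℝ (fderiv ℝ (surf.toFun ∘ param p)) x :=
    (hF.fderiv_right (m := 1) (by norm_cast)).differentiableAt (by simp)
  have hsymm : IsSymmSndFDerivAt ℝ (surf.toFun ∘ param p) x :=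
    hF.isSymmSndFDerivAt (by simp; norm_cast)
  -- Differentiate ⟨N, dF w⟩ = 0 along u; the right-hand side is symmetric because second
  -- derivatives are.
  have key : ∀ u w, ⟪fderiv ℝ (surf.normal ∘ param p) x u, fderiv ℝ (surf.toFun ∘ param p) x w⟫_ℝ
      = -⟪surf.normal (param p x), fderiv ℝ (fderiv ℝ (surf.toFun ∘ param p)) x u w⟫_ℝ := by
    intro u w
    have h0 : fderiv ℝ (fun y => ⟪(surf.normal ∘ param p) y,
        fderiv ℝ (surf.toFun ∘ param p) y w⟫_ℝ) x u = 0 := by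
      have : (fun y => ⟪(surf.normal ∘ param p) y, fderiv ℝ (surf.toFun ∘ param p) y w⟫_ℝ)
          =ᶠ[𝓝 x] fun _ => 0 := by
        filter_upwards [hn] with y hy
        exact surf.inner_normal_fderiv_toFun hy w
      rw [this.fderiv_eq]
      simp
    rw [fderiv_inner_apply ℝ hN (hdF.clm_apply (differentiableAt_const w)),
      fderiv_clm_apply hdF (differentiableAt_const w)] at h0
    simp at h0
    linarith
  rw [key, key, hsymm u w]

/-- Codazzi in coordinates. Differentiating B(dF w) = -dN w along u expresses the left-hand side
through the second derivatives of N and F at (u, w), which are symmetric. -/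
theorem fderiv_extShape_symm {p : M} {x : EuclideanSpace ℝ (Fin 2)} (hx : x ∈ paramDomain p)
    (u w : EuclideanSpace ℝ (Fin 2)) :
    fderiv ℝ (surf.extShape ∘ param p) x u (fderiv ℝ (surf.toFun ∘ param p) x w)
      = fderiv ℝ (surf.extShape ∘ param p) x w (fderiv ℝ (surf.toFun ∘ param p) x u) := by
  have hn := (isOpen_paramDomain p).mem_nhds hx
  have hF := (contDiffOn_comp_param surf.smooth_toFun p).contDiffAt hn
  have hN := (contDiffOn_comp_param surf.smooth_normal p).contDiffAt hn
  have hB : DifferentiableAt ℝ (surf.extShape ∘ param p) x :=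
    ((surf.contDiffOn_extShape_param p).contDiffAt hn).differentiableAt (by simp)
  have hdF : DifferentiableAt ℝ (fderiv ℝ (surf.toFun ∘ param p)) x :=
    (hF.fderiv_right (m := 1) (by norm_cast)).differentiableAt (by simp)
  have hdN : DifferentiableAt ℝ (fderiv ℝ (surf.normal ∘ param p)) x :=
    (hN.fderiv_right (m := 1) (by norm_cast)).differentiableAt (by simp)
  have hsF : IsSymmSndFDerivAt ℝ (surf.toFun ∘ param p) x := hF.isSymmSndFDerivAt (by simp; norm_cast)
  have hsN : IsSymmSndFDerivAt ℝ (surf.normal ∘ param p) x := hN.isSymmSndFDerivAt (by simp; norm_cast)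
  have key : ∀ u w, fderiv ℝ (surf.extShape ∘ param p) x u (fderiv ℝ (surf.toFun ∘ param p) x w)
      = -fderiv ℝ (fderiv ℝ (surf.normal ∘ param p)) x u w
        - surf.extShape (param p x) (fderiv ℝ (fderiv ℝ (surf.toFun ∘ param p)) x u w) := by
    intro u w
    have h0 : fderiv ℝ (fun y => (surf.extShape ∘ param p) y
        (fderiv ℝ (surf.toFun ∘ param p) y w)) x u
        = fderiv ℝ (fun y => -fderiv ℝ (surf.normal ∘ param p) y w) x u := by
      have : (fun y => (surf.extShape ∘ param p) y (fderiv ℝ (surf.toFun ∘ param p) y w))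
          =ᶠ[𝓝 x] fun y => -fderiv ℝ (surf.normal ∘ param p) y w := by
        filter_upwards [hn] with y hy
        exact surf.extShape_fderiv hy w
      rw [this.fderiv_eq]
    rw [fderiv_clm_apply hB (hdF.clm_apply (differentiableAt_const w)),
      fderiv_clm_apply hdF (differentiableAt_const w), fderiv_fun_neg,
      fderiv_clm_apply hdN (differentiableAt_const w)] at h0
    simp at h0
    rw [← h0]
    abel
  rw [key, key, hsF u w, hsN u w]

theorem extShape_symm (p : M) (v w : E3) :
    ⟪surf.extShape p v, w⟫_ℝ = ⟪v, surf.extShape p w⟫_ℝ := by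
  have htan : ∀ v w : surf.tangentPlane p,
      ⟪surf.extShape p v, (w : E3)⟫_ℝ = ⟪(v : E3), surf.extShape p w⟫_ℝ := by
    have hx := mem_extChartAt_target (I := 𝓡 2) p
    have hp := param_extChartAt p
    rintro ⟨v, hv⟩ ⟨w, hw⟩
    obtain ⟨u, hu⟩ := (surf.mem_tangentPlane_param_iff hx (v := v)).1 (by rwa [hp])
    obtain ⟨z, hz⟩ := (surf.mem_tangentPlane_param_iff hx (v := w)).1 (by rwa [hp])
    have h1 := surf.extShape_fderiv hx u
    have h2 := surf.extShape_fderiv hx z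
    rw [hp] at h1 h2
    dsimp only
    rw [← hu, ← hz, h1, h2, inner_neg_left, inner_neg_right, surf.inner_fderiv_normal_symm hx,
      real_inner_comm]
  -- B ignores normal components and has tangent values, so symmetry on tangent vectors suffices.
  have h1 : ∀ v : E3, surf.extShape p v = surf.extShape p (surf.tangentProj p v) := by
    intro v
    simp [extShape, extendEnd, tangentProj_coe]
  have h2 : ∀ v w : E3, ⟪surf.extShape p v, (surf.tangentProj p w : E3)⟫_ℝ
      = ⟪surf.extShape p v, w⟫_ℝ := fun v w =>
    surf.inner_coe_tangentProj ⟨_, surf.extendEnd_mem _ p v⟩ w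
  rw [← h2, h1 v, htan, real_inner_comm, ← h1 w, h2, real_inner_comm]

theorem shapeOperator_isSymmetric (p : M) : (surf.shapeOperator p).toLinearMap.IsSymmetric := by
  intro v w
  have := surf.extShape_symm p v w
  rwa [extShape, extendEnd_coe, extendEnd_coe] at this

/-- The Codazzi equation. -/
theorem dirDeriv_extShape_symm (p : M) (v w : surf.tangentPlane p) :
    surf.dirDeriv surf.extShape p v w = surf.dirDeriv surf.extShape p w v := by
  have aux : ∀ x ∈ paramDomain p, ∀ v w : surf.tangentPlane (param p x),
      surf.dirDeriv surf.extShape (param p x) v w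
        = surf.dirDeriv surf.extShape (param p x) w v := by
    rintro x hx ⟨v, hv⟩ ⟨w, hw⟩
    obtain ⟨u, rfl⟩ := (surf.mem_tangentPlane_param_iff hx).1 hv
    obtain ⟨z, rfl⟩ := (surf.mem_tangentPlane_param_iff hx).1 hw
    rw [surf.dirDeriv_eq_fderiv hx (surf.mdifferentiableAt_extShape _) (u := u) rfl,
      surf.dirDeriv_eq_fderiv hx (surf.mdifferentiableAt_extShape _) (u := z) rfl]
    exact surf.fderiv_extShape_symm hx u z
  have := aux _ (mem_extChartAt_target p)
  rw [param_extChartAt] at this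
  exact this v w

/-- The derivative of the (symmetric) extended shape operator is symmetric. -/
theorem dirDeriv_extShape_inner (p : M) (v : surf.tangentPlane p) (a b : E3) :
    ⟪surf.dirDeriv surf.extShape p v a, b⟫_ℝ = ⟪a, surf.dirDeriv surf.extShape p v b⟫_ℝ := by
  have aux : ∀ x ∈ paramDomain p, ∀ v : surf.tangentPlane (param p x),
      ⟪surf.dirDeriv surf.extShape (param p x) v a, b⟫_ℝ
        = ⟪a, surf.dirDeriv surf.extShape (param p x) v b⟫_ℝ := by
    rintro x hx ⟨v, hv⟩
    obtain ⟨u, rfl⟩ := (surf.mem_tangentPlane_param_iff hx).1 hv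
    have hB : DifferentiableAt ℝ (surf.extShape ∘ param p) x :=
      ((surf.contDiffOn_extShape_param p).contDiffAt
        ((isOpen_paramDomain p).mem_nhds hx)).differentiableAt (by simp)
    rw [surf.dirDeriv_eq_fderiv hx (surf.mdifferentiableAt_extShape _) (u := u) rfl]
    have h0 : fderiv ℝ (fun y => ⟪(surf.extShape ∘ param p) y a, b⟫_ℝ) x u
        = fderiv ℝ (fun y => ⟪a, (surf.extShape ∘ param p) y b⟫_ℝ) x u := by
      congr 2
      funext y
      exact surf.extShape_symm _ a b
    rw [fderiv_inner_apply ℝ (hB.clm_apply (differentiableAt_const a)) (differentiableAt_const b),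
      fderiv_inner_apply ℝ (differentiableAt_const a) (hB.clm_apply (differentiableAt_const b)),
      fderiv_clm_apply hB (differentiableAt_const a),
      fderiv_clm_apply hB (differentiableAt_const b)] at h0
    simpa using h0
  have := aux _ (mem_extChartAt_target p)
  rw [param_extChartAt] at this
  exact this v

end Manifold

/-! ### Principal curvatures and their smoothness. -/

theorem trace_extShape (p : M) : LinearMap.trace ℝ E3 (surf.extShape p).toLinearMap
    = LinearMap.trace ℝ _ (surf.shapeOperator p).toLinearMap := by
  have h1 : (surf.extShape p).toLinearMap = (surf.tangentPlane p).subtype ∘ₗ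
      ((surf.shapeOperator p).toLinearMap ∘ₗ (surf.tangentProj p).toLinearMap) := rfl
  have h2 : (surf.tangentProj p).toLinearMap ∘ₗ (surf.tangentPlane p).subtype = LinearMap.id := by
    ext1 v
    exact surf.tangentProj_coe v
  rw [h1, LinearMap.trace_comp_comm', LinearMap.comp_assoc, h2, LinearMap.comp_id]

theorem trace_extShape_sq (p : M) :
    LinearMap.trace ℝ E3 (surf.extShape p ∘L surf.extShape p).toLinearMap
      = LinearMap.trace ℝ _ (surf.shapeOperator p ∘L surf.shapeOperator p).toLinearMap := by
  have h1 : (surf.extShape p ∘L surf.extShape p).toLinearMap = (surf.tangentPlane p).subtype ∘ₗ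
      ((surf.shapeOperator p ∘L surf.shapeOperator p).toLinearMap
        ∘ₗ (surf.tangentProj p).toLinearMap) := by
    ext1 v
    simp [extendEnd, tangentProj_coe]
  have h2 : (surf.tangentProj p).toLinearMap ∘ₗ (surf.tangentPlane p).subtype = LinearMap.id := by
    ext1 v
    exact surf.tangentProj_coe v
  rw [h1, LinearMap.trace_comp_comm', LinearMap.comp_assoc, h2, LinearMap.comp_id]

theorem inner_coe_orthonormalBasis {p : M}
    (e : OrthonormalBasis (Fin 2) ℝ (surf.tangentPlane p)) (i : Fin 2) :
    ⟪(e i : E3), (e i : E3)⟫_ℝ = 1 := by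
  rw [real_inner_self_eq_norm_sq, ← Submodule.coe_norm, e.norm_eq_one, one_pow]

variable {surf} in
theorem ArePrincipalCurvatures.symm {κ₁ κ₂ : M → ℝ}
    (hκ : surf.ArePrincipalCurvatures κ₁ κ₂) :
    surf.ArePrincipalCurvatures κ₂ κ₁ := hκ.elim (fun h => Or.inr h.symm) fun h => Or.inl h.symm

section Manifold

variable [IsManifold (𝓡 2) ∞ M]

/-- The shape operator is diagonalized by an orthonormal basis, with the principal curvatures as
eigenvalues. -/
theorem exists_principal_basis (p : M) :
    ∃ e : OrthonormalBasis (Fin 2) ℝ (surf.tangentPlane p),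
      surf.shapeOperator p (e 0) = surf.maxPrincipalCurvature p • e 0 ∧
      surf.shapeOperator p (e 1) = surf.minPrincipalCurvature p • e 1 := by
  have hS := surf.shapeOperator_isSymmetric p
  have hd := surf.finrank_tangentPlane p
  let e := hS.eigenvectorBasis hd
  let c := hS.eigenvalues hd
  have he : ∀ i, surf.shapeOperator p (e i) = c i • e i := fun i => hS.apply_eigenvectorBasis hd i
  -- Eigenvalues are listed in decreasing order, so index 0 carries the maximum.
  have hc : c 1 ≤ c 0 := hS.eigenvalues_antitone hd (by decide)
  have hset : {a : ℝ | Module.End.HasEigenvalue (surf.shapeOperator p).toLinearMap a}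
      = {c 0, c 1} := by
    ext a
    simp only [Set.mem_ofPred_eq, Set.mem_insert_iff, Set.mem_singleton_iff]
    constructor
    · intro ha
      obtain ⟨v, hv⟩ := ha.exists_hasEigenvector
      have hv1 : surf.shapeOperator p v = a • v := hv.apply_eq_smul
      have hcoord : ∀ i, c i * ⟪e i, v⟫_ℝ = a * ⟪e i, v⟫_ℝ := by
        intro i
        have := hS (e i) v
        change ⟪surf.shapeOperator p (e i), v⟫_ℝ = ⟪e i, surf.shapeOperator p v⟫_ℝ at this
        rw [he, hv1] at this
        simpa only [Submodule.coe_inner, Submodule.coe_smul, real_inner_smul_left,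
          real_inner_smul_right] using this
      by_contra! hne
      have hz : ∀ i, ⟪e i, v⟫_ℝ = 0 := by
        intro i
        by_contra h
        have := mul_right_cancel₀ h (hcoord i)
        fin_cases i
        · exact hne.1 this.symm
        · exact hne.2 this.symm
      refine hv.2 ?_
      rw [← e.sum_repr' v]
      simp [hz]
    · rintro (rfl | rfl) <;> exact hS.hasEigenvalue_eigenvalues hd _
  have hmax : surf.maxPrincipalCurvature p = c 0 := by
    rw [maxPrincipalCurvature, hset, csSup_pair, sup_eq_left.2 hc]
  have hmin : surf.minPrincipalCurvature p = c 1 := by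
    rw [minPrincipalCurvature, hset, csInf_pair, inf_eq_right.2 hc]
  exact ⟨e, by rw [hmax, he], by rw [hmin, he]⟩

theorem minPrincipalCurvature_le_max (p : M) :
    surf.minPrincipalCurvature p ≤ surf.maxPrincipalCurvature p := by
  have hS := surf.shapeOperator_isSymmetric p
  have hd := surf.finrank_tangentPlane p
  have hfin : {a : ℝ | Module.End.HasEigenvalue (surf.shapeOperator p).toLinearMap a}.Finite :=
    Module.End.finite_hasEigenvalue _
  have h := hS.hasEigenvalue_eigenvalues hd 0
  exact (csInf_le hfin.bddBelow h).trans (le_csSup hfin.bddAbove h)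

/-- With the trace of the square below, this gives smooth symmetric functions that determine both
curvatures. -/
theorem trace_extShape_eq (p : M) : LinearMap.trace ℝ E3 (surf.extShape p).toLinearMap
    = surf.maxPrincipalCurvature p + surf.minPrincipalCurvature p := by
  obtain ⟨e, h0, h1⟩ := surf.exists_principal_basis p
  rw [trace_extShape, LinearMap.trace_eq_sum_inner _ e, Fin.sum_univ_two]
  change ⟪e 0, surf.shapeOperator p (e 0)⟫_ℝ + ⟪e 1, surf.shapeOperator p (e 1)⟫_ℝ = _
  rw [h0, h1]
  simp only [Submodule.coe_inner, Submodule.coe_smul, real_inner_smul_right,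
    inner_coe_orthonormalBasis]
  ring

theorem trace_extShape_sq_eq (p : M) :
    LinearMap.trace ℝ E3 (surf.extShape p ∘L surf.extShape p).toLinearMap
      = surf.maxPrincipalCurvature p ^ 2 + surf.minPrincipalCurvature p ^ 2 := by
  obtain ⟨e, h0, h1⟩ := surf.exists_principal_basis p
  rw [trace_extShape_sq, LinearMap.trace_eq_sum_inner _ e, Fin.sum_univ_two]
  change ⟪e 0, surf.shapeOperator p (surf.shapeOperator p (e 0))⟫_ℝ
    + ⟪e 1, surf.shapeOperator p (surf.shapeOperator p (e 1))⟫_ℝ = _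
  rw [h0, h1, map_smul, map_smul, h0, h1]
  simp only [Submodule.coe_inner, Submodule.coe_smul, real_inner_smul_right,
    inner_coe_orthonormalBasis]
  ring

variable {surf} {κ₁ κ₂ : M → ℝ}

theorem ArePrincipalCurvatures.exists_basis (hκ : surf.ArePrincipalCurvatures κ₁ κ₂) (p : M) :
    ∃ e : OrthonormalBasis (Fin 2) ℝ (surf.tangentPlane p),
      surf.shapeOperator p (e 0) = κ₁ p • e 0 ∧ surf.shapeOperator p (e 1) = κ₂ p • e 1 := by
  obtain ⟨e, h0, h1⟩ := surf.exists_principal_basis p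
  rcases hκ with ⟨rfl, rfl⟩ | ⟨rfl, rfl⟩
  · exact ⟨e, h0, h1⟩
  · exact ⟨e.reindex (Equiv.swap 0 1), by simpa using h1, by simpa using h0⟩

/-- The Cayley–Hamilton identity for the shape operator. -/
theorem ArePrincipalCurvatures.shapeOperator_sub_mul (hκ : surf.ArePrincipalCurvatures κ₁ κ₂)
    (p : M) (v : surf.tangentPlane p) :
    surf.shapeOperator p (surf.shapeOperator p v - κ₂ p • v)
      = κ₁ p • (surf.shapeOperator p v - κ₂ p • v) := by
  obtain ⟨e, h0, h1⟩ := hκ.exists_basis p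
  rw [← e.sum_repr v, Fin.sum_univ_two]
  simp only [map_add, map_smul, map_sub, h0, h1]
  module

theorem ArePrincipalCurvatures.isUmbilical (hκ : surf.ArePrincipalCurvatures κ₁ κ₂) {p : M}
    (h : κ₁ p = κ₂ p) : surf.IsUmbilical p := by
  obtain ⟨e, h0, h1⟩ := hκ.exists_basis p
  refine ⟨κ₁ p, fun v => ?_⟩
  rw [← e.sum_repr v, Fin.sum_univ_two]
  simp only [map_add, map_smul, h0, h1, ← h]
  module

/-- At non-umbilical points the principal curvatures are smooth. -/
theorem ArePrincipalCurvatures.contMDiffAt (hκ : surf.ArePrincipalCurvatures κ₁ κ₂) {p : M}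
    (hp : ¬ surf.IsUmbilical p) : ContMDiffAt (𝓡 2) 𝓘(ℝ, ℝ) ∞ κ₁ p := by
  let tr : (E3 →L[ℝ] E3) →L[ℝ] ℝ := LinearMap.toContinuousLinearMap
    ((LinearMap.trace ℝ E3) ∘ₗ (ContinuousLinearMap.coeLM ℝ))
  let t : M → ℝ := fun q => tr (surf.extShape q)
  let s : M → ℝ := fun q => tr (surf.extShape q ∘L surf.extShape q)
  have ht : ContMDiffAt (𝓡 2) 𝓘(ℝ, ℝ) ∞ t p :=
    (tr.contDiff.contMDiff.comp surf.contMDiff_extShape) p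
  have hs : ContMDiffAt (𝓡 2) 𝓘(ℝ, ℝ) ∞ s p :=
    (tr.contDiff.contMDiff.comp (surf.contMDiff_extShape.clm_comp surf.contMDiff_extShape)) p
  have et : ∀ q, t q = surf.maxPrincipalCurvature q + surf.minPrincipalCurvature q :=
    surf.trace_extShape_eq
  have es : ∀ q, s q = surf.maxPrincipalCurvature q ^ 2 + surf.minPrincipalCurvature q ^ 2 :=
    surf.trace_extShape_sq_eq
  -- This discriminant vanishes only at umbilics; elsewhere its square root is smooth, and the
  -- curvatures are (t ± √(2s - t²)) / 2.
  have hdisc : ∀ q, 2 * s q - t q * t q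
      = (surf.maxPrincipalCurvature q - surf.minPrincipalCurvature q) ^ 2 := by
    intro q
    rw [et, es]
    ring
  have hroot : ∀ q, √(2 * s q - t q * t q)
      = surf.maxPrincipalCurvature q - surf.minPrincipalCurvature q := by
    intro q
    rw [hdisc, Real.sqrt_sq (sub_nonneg.2 (surf.minPrincipalCurvature_le_max q))]
  have hne : 2 * s p - t p * t p ≠ 0 := by
    rw [hdisc]
    refine pow_ne_zero 2 (sub_ne_zero.2 fun h => hp ?_)
    exact ArePrincipalCurvatures.isUmbilical (Or.inl ⟨rfl, rfl⟩) h
  have hD : ContMDiffAt (𝓡 2) 𝓘(ℝ, ℝ) ∞ (fun q => √(2 * s q - t q * t q)) p :=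
    (Real.contDiffAt_sqrt hne).contMDiffAt.comp (f := fun q => 2 * s q - t q * t q) p
      ((contMDiffAt_const.mul hs).sub (ht.mul ht))
  rcases hκ with ⟨rfl, rfl⟩ | ⟨rfl, rfl⟩
  · refine ((contMDiffAt_const (c := (1 / 2 : ℝ))).mul (ht.add hD)).congr_of_eventuallyEq
      (Filter.Eventually.of_forall fun q => ?_)
    change _ = 1 / 2 * (t q + √(2 * s q - t q * t q))
    rw [hroot, et]
    ring
  · refine ((contMDiffAt_const (c := (1 / 2 : ℝ))).mul (ht.sub hD)).congr_of_eventuallyEq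
      (Filter.Eventually.of_forall fun q => ?_)
    change _ = 1 / 2 * (t q - √(2 * s q - t q * t q))
    rw [hroot, et]
    ring

end Manifold

/-! ### Cross products and Darboux frames. -/

theorem inner_E3_eq (u v : E3) : ⟪u, v⟫_ℝ = u 0 * v 0 + u 1 * v 1 + u 2 * v 2 := by
  simp only [PiLp.inner_apply, Fin.sum_univ_three, RCLike.inner_apply, conj_trivial]
  ring

theorem inner_cross3_cross3 (u v : E3) :
    ⟪cross3 u v, cross3 u v⟫_ℝ = ⟪u, u⟫_ℝ * ⟪v, v⟫_ℝ - ⟪u, v⟫_ℝ ^ 2 := by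
  simp only [inner_E3_eq]
  simp [cross3, crossProduct]
  ring

theorem cross3_cross3_self (u v : E3) :
    cross3 (cross3 u v) u = ⟪u, u⟫_ℝ • v - ⟪u, v⟫_ℝ • u := by
  simp only [inner_E3_eq]
  ext i
  fin_cases i <;>
  · simp [cross3, crossProduct]
    ring

section DarbouxFrame

variable {surf} {κ₁ κ₂ : M → ℝ} {p : M} {v₁ v₂ : surf.tangentPlane p}

theorem IsDarbouxFrame.inner_fst_fst (hv : surf.IsDarbouxFrame κ₁ κ₂ p v₁ v₂) :
    ⟪(v₁ : E3), (v₁ : E3)⟫_ℝ = 1 := by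
  rw [real_inner_self_eq_norm_sq, ← Submodule.coe_norm, hv.norm_fst, one_pow]

/-- Lagrange's identity: two unit vectors whose cross product is a unit vector are orthogonal. -/
theorem IsDarbouxFrame.inner_fst_snd (hv : surf.IsDarbouxFrame κ₁ κ₂ p v₁ v₂) :
    ⟪(v₁ : E3), (v₂ : E3)⟫_ℝ = 0 := by
  have h2 : ⟪(v₂ : E3), (v₂ : E3)⟫_ℝ = 1 := by
    rw [real_inner_self_eq_norm_sq, ← Submodule.coe_norm, hv.norm_snd, one_pow]
  have h := inner_cross3_cross3 v₁ v₂
  rw [hv.cross_eq, inner_normal_normal, hv.inner_fst_fst, h2] at h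
  exact pow_eq_zero_iff (n := 2) (by simp) |>.1 (by linarith)

theorem IsDarbouxFrame.cross_normal_fst (hv : surf.IsDarbouxFrame κ₁ κ₂ p v₁ v₂) :
    cross3 (surf.normal p) v₁ = v₂ := by
  rw [← hv.cross_eq, cross3_cross3_self, hv.inner_fst_fst, hv.inner_fst_snd]
  simp

end DarbouxFrame

/-! ### Derivatives along curves, principal fields and the geodesic curvature. -/

/-- The chain rule along a curve. -/
theorem hasDerivAt_comp_mfderiv {F : Type*} [NormedAddCommGroup F] [NormedSpace ℝ F] {X : M → F}
    {γ : ℝ → M} {t : ℝ} (hγ : MDifferentiableAt 𝓘(ℝ, ℝ) (𝓡 2) γ t)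
    (hX : MDifferentiableAt (𝓡 2) 𝓘(ℝ, F) X (γ t)) :
    HasDerivAt (fun s => X (γ s))
      (mfderiv (𝓡 2) 𝓘(ℝ, F) X (γ t) (mfderiv 𝓘(ℝ, ℝ) (𝓡 2) γ t (1 : ℝ)) : F) t := by
  let dX : EuclideanSpace ℝ (Fin 2) →L[ℝ] F := mfderiv (𝓡 2) 𝓘(ℝ, F) X (γ t)
  let dγ : ℝ →L[ℝ] EuclideanSpace ℝ (Fin 2) := mfderiv 𝓘(ℝ, ℝ) (𝓡 2) γ t
  have h : HasFDerivAt (fun s => X (γ s)) (dX ∘L dγ) t :=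
    (hX.hasMFDerivAt.comp t hγ.hasMFDerivAt).hasFDerivAt
  exact h.hasDerivAt

/-- The derivative along a curve, in terms of its velocity. -/
theorem hasDerivAt_comp_curve {F : Type*} [NormedAddCommGroup F] [NormedSpace ℝ F] {X : M → F}
    {γ : ℝ → M} {t : ℝ} (hγ : MDifferentiableAt 𝓘(ℝ, ℝ) (𝓡 2) γ t)
    (hX : MDifferentiableAt (𝓡 2) 𝓘(ℝ, F) X (γ t)) {v : surf.tangentPlane (γ t)}
    (hv : (v : E3) = surf.velocity γ t) :
    HasDerivAt (fun s => X (γ s)) (surf.dirDeriv X (γ t) v) t := by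
  have h := hasDerivAt_comp_mfderiv hγ (surf.smooth_toFun.mdifferentiableAt (by simp))
  rw [surf.dirDeriv_apply X (hv.trans h.deriv)]
  exact hasDerivAt_comp_mfderiv hγ hX

theorem contMDiff_tangentProj (v : E3) :
    ContMDiff (𝓡 2) 𝓘(ℝ, E3) ∞ (fun q => (surf.tangentProj q v : E3)) := by
  simp only [coe_tangentProj]
  have h : ContDiff ℝ ∞ fun w : E3 => v - ⟪w, v⟫_ℝ • w :=
    contDiff_const.sub ((contDiff_id.inner ℝ contDiff_const).smul contDiff_id)
  exact h.contMDiff.comp surf.smooth_normal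

/-- A principal vector field for the principal curvature which is not `κ₂`, obtained from a vector
`v` by projecting it to the tangent planes and applying `S - κ₂`. -/
def principalField (κ₂ : M → ℝ) (v : E3) (q : M) : E3 :=
  surf.extShape q v - κ₂ q • (surf.tangentProj q v : E3)

theorem principalField_eq (κ₂ : M → ℝ) (v : E3) (q : M) : surf.principalField κ₂ v q
    = (surf.shapeOperator q (surf.tangentProj q v) - κ₂ q • surf.tangentProj q v :
        surf.tangentPlane q) := rfl

theorem principalField_mem (κ₂ : M → ℝ) (v : E3) (q : M) :
    surf.principalField κ₂ v q ∈ surf.tangentPlane q := by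
  rw [principalField_eq]
  exact Subtype.mem _

/-- Pairing with a tangent vector sees only the tangential part of the Euclidean derivative, which
is the covariant one. -/
theorem inner_dirDeriv_extShape_le {p : M} (v w : surf.tangentPlane p)
    (hw1 : ⟪(w : E3), (w : E3)⟫_ℝ = 1) :
    |⟪surf.dirDeriv surf.extShape p v w, (w : E3)⟫_ℝ|
      ≤ ‖surf.covDerivEnd surf.shapeOperator p v‖ := by
  have hn : ‖w‖ = 1 := by
    rw [Submodule.coe_norm, ← sq_eq_sq₀ (norm_nonneg _) zero_le_one, ← real_inner_self_eq_norm_sq,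
      hw1, one_pow]
  have h : ⟪surf.dirDeriv surf.extShape p v w, (w : E3)⟫_ℝ
      = ⟪w, surf.covDerivEnd surf.shapeOperator p v w⟫_ℝ := by
    rw [real_inner_comm, ← surf.inner_coe_tangentProj w]
    rfl
  rw [h]
  calc _ ≤ ‖w‖ * ‖surf.covDerivEnd surf.shapeOperator p v w‖ := abs_real_inner_le_norm _ _
    _ ≤ ‖w‖ * (‖surf.covDerivEnd surf.shapeOperator p v‖ * ‖w‖) := by
        gcongr
        exact ContinuousLinearMap.le_opNorm _ _
    _ = _ := by rw [hn]; ring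

theorem principalField_self {κ₂ : M → ℝ} {p : M} {v : surf.tangentPlane p} {c : ℝ}
    (hv : surf.shapeOperator p v = c • v) :
    surf.principalField κ₂ v p = (c - κ₂ p) • (v : E3) := by
  rw [principalField_eq, tangentProj_coe, hv, ← sub_smul, Submodule.coe_smul]

section Manifold

variable [IsManifold (𝓡 2) ∞ M]

theorem exists_fderiv_eq {p : M} (v : surf.tangentPlane p) :
    ∃ u, (v : E3) = fderiv ℝ (surf.toFun ∘ param p) (extChartAt (𝓡 2) p p) u := by
  obtain ⟨u, hu⟩ := (surf.mem_tangentPlane_param_iff (mem_extChartAt_target (I := 𝓡 2) p)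
    (v := (v : E3))).1 (by rw [param_extChartAt]; exact v.2)
  exact ⟨u, hu.symm⟩

/-- The directional derivative at `p`, computed in the chart at `p`. -/
theorem dirDeriv_eq_fderiv_self {F : Type*} [NormedAddCommGroup F] [NormedSpace ℝ F] {X : M → F}
    {p : M} (hX : MDifferentiableAt (𝓡 2) 𝓘(ℝ, F) X p) {v : surf.tangentPlane p}
    {u : EuclideanSpace ℝ (Fin 2)}
    (h : (v : E3) = fderiv ℝ (surf.toFun ∘ param p) (extChartAt (𝓡 2) p p) u) :
    surf.dirDeriv X p v = fderiv ℝ (X ∘ param p) (extChartAt (𝓡 2) p p) u := by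
  -- The type of `v` depends on the point, and `param p` returns `p` only propositionally; a free
  -- `q` permits substitution.
  have aux : ∀ q, q = p → MDifferentiableAt (𝓡 2) 𝓘(ℝ, F) X q → ∀ v : surf.tangentPlane q,
      param p (extChartAt (𝓡 2) p p) = q →
      (v : E3) = fderiv ℝ (surf.toFun ∘ param p) (extChartAt (𝓡 2) p p) u →
      surf.dirDeriv X q v = fderiv ℝ (X ∘ param p) (extChartAt (𝓡 2) p p) u := by
    rintro _ - hX v rfl hv
    exact surf.dirDeriv_eq_fderiv (mem_extChartAt_target p) hX hv
  exact aux p rfl hX v (param_extChartAt p) h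

theorem contDiffAt_comp_param {F : Type*} [NormedAddCommGroup F] [NormedSpace ℝ F] {X : M → F}
    {p : M} (hX : ContMDiffAt (𝓡 2) 𝓘(ℝ, F) ∞ X p) :
    ContDiffAt ℝ ∞ (X ∘ param p) (extChartAt (𝓡 2) p p) := by
  refine contMDiffAt_iff_contDiffAt.1 (ContMDiffAt.comp _ ?_
    (contMDiffAt_param (mem_extChartAt_target p)))
  rwa [param_extChartAt]

theorem contMDiffAt_principalField {κ₂ : M → ℝ} {p : M}
    (h : ContMDiffAt (𝓡 2) 𝓘(ℝ, ℝ) ∞ κ₂ p) (v : E3) :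
    ContMDiffAt (𝓡 2) 𝓘(ℝ, E3) ∞ (surf.principalField κ₂ v) p :=
  (surf.contMDiff_extShape.contMDiffAt.clm_apply contMDiffAt_const).sub
    (h.smul (surf.contMDiff_tangentProj v).contMDiffAt)

theorem extShape_principalField {κ₁ κ₂ : M → ℝ} (hκ : surf.ArePrincipalCurvatures κ₁ κ₂) (v : E3)
    (q : M) : surf.extShape q (surf.principalField κ₂ v q)
      = κ₁ q • surf.principalField κ₂ v q := by
  rw [principalField_eq, extShape, extendEnd_coe, hκ.shapeOperator_sub_mul, Submodule.coe_smul]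

/-- The derivative of a principal curvature. -/
theorem dirDeriv_principalCurvature {κ₁ κ₂ : M → ℝ} (hκ : surf.ArePrincipalCurvatures κ₁ κ₂) {p : M}
    (hp : ¬ surf.IsUmbilical p) {w : surf.tangentPlane p}
    (hw : surf.shapeOperator p w = κ₁ p • w) (hw1 : ⟪(w : E3), (w : E3)⟫_ℝ = 1)
    (v : surf.tangentPlane p) :
    surf.dirDeriv κ₁ p v = ⟪surf.dirDeriv surf.extShape p v w, (w : E3)⟫_ℝ := by
  have hne : κ₁ p - κ₂ p ≠ 0 := sub_ne_zero.2 fun h => hp (hκ.isUmbilical h)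
  have hk := hκ.contMDiffAt hp
  have hW := surf.contMDiffAt_principalField (hκ.symm.contMDiffAt hp) w
  obtain ⟨u, hu⟩ := surf.exists_fderiv_eq v
  rw [surf.dirDeriv_eq_fderiv_self (hk.mdifferentiableAt (by simp)) hu,
    surf.dirDeriv_eq_fderiv_self (surf.mdifferentiableAt_extShape p) hu]
  have hp0 := param_extChartAt p
  have hWp := surf.principalField_self (κ₂ := κ₂) hw
  have hBw : surf.extShape p w = κ₁ p • (w : E3) := by
    rw [extShape, extendEnd_coe, hw, Submodule.coe_smul]
  have dk := (contDiffAt_comp_param hk).differentiableAt (by simp)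
  have dW := (contDiffAt_comp_param hW).differentiableAt (by simp)
  have dB := (contDiffAt_comp_param (surf.contMDiff_extShape p)).differentiableAt (by simp)
  set x := extChartAt (𝓡 2) p p
  have h0 : fderiv ℝ (fun y => (surf.extShape ∘ param p) y
        ((surf.principalField κ₂ w ∘ param p) y)) x u
      = fderiv ℝ (fun y => (κ₁ ∘ param p) y • (surf.principalField κ₂ w ∘ param p) y) x u := by
    congr 2
    funext y
    exact surf.extShape_principalField hκ w _
  rw [fderiv_clm_apply dB dW, fderiv_fun_smul dk dW] at h0
  -- By symmetry ⟨B(dW), w⟩ = κ₁⟨dW, w⟩, so the derivative of the field cancels; what remains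
  -- carries the nonzero factor κ₁ - κ₂, since the field equals (κ₁ - κ₂) w at p.
  have h1 := congrArg (fun z => ⟪z, (w : E3)⟫_ℝ) h0
  simp only [add_apply, ContinuousLinearMap.comp_apply, ContinuousLinearMap.flip_apply,
    Function.comp_apply, hp0, hWp, map_smul, smul_apply, inner_add_left,
    real_inner_smul_left, surf.extShape_symm p _ (w : E3), hBw, real_inner_smul_right, hw1,
    ContinuousLinearMap.smulRight_apply] at h1
  refine mul_left_cancel₀ hne ?_
  simp only [Function.comp_def] at h1 ⊢
  linarith

theorem exists_local_bound (p : M) : ∃ C : ℝ, ∀ᶠ q in 𝓝 p, ∀ v : surf.tangentPlane q, ‖v‖ = 1 →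
    ‖surf.covDerivEnd surf.shapeOperator q v‖ ≤ C := by
  -- A continuous extension of v ↦ D_v B from the varying tangent planes to all of `E3`; its norm
  -- dominates that of ∇_v S for unit v.
  let A : EuclideanSpace ℝ (Fin 2) → (E3 →L[ℝ] (E3 →L[ℝ] E3)) := fun x =>
    fderiv ℝ (surf.extShape ∘ param p) x ∘L
      (ContinuousLinearMap.fst ℝ _ ℝ ∘L (surf.frameMap p x).inverse)
  have hA : ContinuousOn A (paramDomain p) := by
    have h1 : ContDiffOn ℝ ∞ (fderiv ℝ (surf.extShape ∘ param p)) (paramDomain p) :=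
      (surf.contDiffOn_extShape_param p).fderiv_of_isOpen (isOpen_paramDomain p) (by simp)
    exact (h1.clm_comp (contDiffOn_const.clm_comp (surf.contDiffOn_frameMap_inverse p))).continuousOn
  have hbound : ∀ x ∈ paramDomain p, ∀ v : surf.tangentPlane (param p x), ‖v‖ = 1 →
      ‖surf.covDerivEnd surf.shapeOperator (param p x) v‖ ≤ ‖A x‖ := by
    intro x hx v hv
    have h1 : surf.dirDeriv surf.extShape (param p x) v = A x v :=
      surf.dirDeriv_eq_fderiv hx (surf.mdifferentiableAt_extShape _)
        (surf.fderiv_frameMap_inverse hx v.2).symm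
    have h2 : ‖A x v‖ ≤ ‖A x‖ := by
      refine ((A x).le_opNorm v).trans ?_
      rw [← Submodule.coe_norm, hv, mul_one]
    refine ContinuousLinearMap.opNorm_le_bound _ (norm_nonneg (A x)) fun w => ?_
    change ‖surf.tangentProj (param p x) (surf.dirDeriv surf.extShape (param p x) v w)‖ ≤ _
    refine (Submodule.norm_orthogonalProjectionOnto_apply_le _ _).trans ?_
    rw [h1]
    refine ((A x v).le_opNorm w).trans ?_
    gcongr
    rfl
  have hx := mem_extChartAt_target (I := 𝓡 2) p
  have hev : ∀ᶠ x in 𝓝 (extChartAt (𝓡 2) p p), x ∈ paramDomain p ∧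
      ‖A x‖ < ‖A (extChartAt (𝓡 2) p p)‖ + 1 := by
    have hn := (isOpen_paramDomain p).mem_nhds hx
    have hc : ContinuousAt (fun x => ‖A x‖) (extChartAt (𝓡 2) p p) :=
      ContinuousAt.norm (E := E3 →L[ℝ] (E3 →L[ℝ] E3)) (hA.continuousAt hn)
    exact ((isOpen_paramDomain p).eventually_mem hx).and (hc.eventually_lt continuousAt_const (lt_add_one _))
  refine ⟨‖A (extChartAt (𝓡 2) p p)‖ + 1, ?_⟩
  filter_upwards [(continuousAt_extChartAt (I := 𝓡 2) p).eventually hev,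
    extChartAt_source_mem_nhds (I := 𝓡 2) p] with q hq hqs
  have := hbound _ hq.1
  rw [show param p (extChartAt (𝓡 2) p q) = q from (extChartAt (𝓡 2) p).left_inv hqs] at this
  exact fun v hv => (this v hv).trans hq.2.le

/-- A real `sSup` dominates the members of its set only if the set is bounded above; compactness
turns the local bounds into a global one. -/
theorem norm_covDerivEnd_le_shapeDerivBound [CompactSpace M] {p : M} {v : surf.tangentPlane p}
    (hv : ‖v‖ = 1) : ‖surf.covDerivEnd surf.shapeOperator p v‖ ≤ surf.shapeDerivBound := by
  have h : ∃ C : ℝ, ∀ q ∈ (Set.univ : Set M), ∀ v : surf.tangentPlane q, ‖v‖ = 1 →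
      ‖surf.covDerivEnd surf.shapeOperator q v‖ ≤ C := by
    refine isCompact_univ.induction_on
      (p := fun s => ∃ C : ℝ, ∀ q ∈ s, ∀ v : surf.tangentPlane q, ‖v‖ = 1 →
      ‖surf.covDerivEnd surf.shapeOperator q v‖ ≤ C) ⟨0, by simp⟩ ?_ ?_ ?_
    · rintro s t hst ⟨C, hC⟩
      exact ⟨C, fun q hq => hC q (hst hq)⟩
    · rintro s t ⟨C, hC⟩ ⟨D, hD⟩
      refine ⟨max C D, fun q hq v hv => ?_⟩
      rcases hq with hq | hq
      · exact (hC q hq v hv).trans (le_max_left _ _)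
      · exact (hD q hq v hv).trans (le_max_right _ _)
    · intro q _
      obtain ⟨C, hC⟩ := surf.exists_local_bound q
      exact ⟨_, mem_nhdsWithin_of_mem_nhds hC, C, fun q hq => hq⟩
  obtain ⟨C, hC⟩ := h
  refine le_csSup ⟨C, ?_⟩ ⟨p, v, hv, rfl⟩
  rintro _ ⟨q, w, hw, rfl⟩
  exact hC q trivial w hw

theorem geodesicCurvature_mul {κ₁ κ₂ : M → ℝ} {γ : ℝ → M} {a b t : ℝ} (ht : t ∈ Set.Ioo a b)
    (hγ : surf.IsCurvatureLineOn γ a b) {v₁ v₂ : surf.tangentPlane (γ t)}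
    (hv : surf.IsDarbouxFrame κ₁ κ₂ (γ t) v₁ v₂) (hvel : surf.velocity γ t = v₁) :
    (κ₁ (γ t) - κ₂ (γ t)) * surf.geodesicCurvature γ t
      = ⟪surf.dirDeriv surf.extShape (γ t) v₁ v₁, (v₂ : E3)⟫_ℝ := by
  have hnhds := isOpen_Ioo.mem_nhds ht
  have hγt : MDifferentiableAt 𝓘(ℝ, ℝ) (𝓡 2) γ t :=
    (hγ.contMDiffOn.contMDiffAt hnhds).mdifferentiableAt (by simp)
  have hg : ContDiffOn ℝ 2 (fun s => surf.toFun (γ s)) (Set.Ioo a b) :=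
    contMDiffOn_iff_contDiffOn.1
      ((surf.smooth_toFun.of_le (by norm_cast)).comp_contMDiffOn hγ.contMDiffOn)
  have hT : HasDerivAt (surf.velocity γ) (deriv (surf.velocity γ) t) t := by
    have h1 : ContDiffOn ℝ 1 (surf.velocity γ) (Set.Ioo a b) :=
      hg.deriv_of_isOpen isOpen_Ioo (by norm_num)
    exact ((h1.contDiffAt hnhds).differentiableAt (by simp)).hasDerivAt
  have hB := surf.hasDerivAt_comp_curve hγt (surf.mdifferentiableAt_extShape _) hvel.symm
  have hBT := hB.clm_apply hT
  -- Writing the eigenvalue as ⟨BT, T⟩ makes it differentiable along the curve, without deciding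
  -- which principal curvature it is.
  have hprin : ∀ s ∈ Set.Ioo a b, surf.extShape (γ s) (surf.velocity γ s)
      = ⟪surf.extShape (γ s) (surf.velocity γ s), surf.velocity γ s⟫_ℝ • surf.velocity γ s := by
    intro s hs
    obtain ⟨v, hv, c, hc⟩ := hγ.principal s hs
    have h1 := hγ.norm_velocity s hs
    rw [← hv] at h1 ⊢
    rw [extShape, extendEnd_coe, hc, Submodule.coe_smul, real_inner_smul_left,
      real_inner_self_eq_norm_sq, h1]
    simp
  have hR := (hBT.inner ℝ hT).smul hT
  have heq := (hBT.congr_of_eventuallyEq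
    (Filter.eventually_of_mem hnhds fun s hs => (hprin s hs).symm)).unique hR
  have hB1 : surf.extShape (γ t) v₁ = κ₁ (γ t) • (v₁ : E3) := by
    rw [extShape, extendEnd_coe, hv.shape_fst, Submodule.coe_smul]
  have hB2 : surf.extShape (γ t) v₂ = κ₂ (γ t) • (v₂ : E3) := by
    rw [extShape, extendEnd_coe, hv.shape_snd, Submodule.coe_smul]
  -- The derivative of the eigenvalue multiplies v₁ ⊥ v₂ and drops out; symmetry turns ⟨BT', v₂⟩
  -- into κ₂⟨T', v₂⟩.
  have h1 := congrArg (fun z => ⟪z, (v₂ : E3)⟫_ℝ) heq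
  simp only [hvel, inner_add_left, real_inner_smul_left, hB1, hv.inner_fst_fst, hv.inner_fst_snd,
    surf.extShape_symm _ _ (v₂ : E3), hB2, real_inner_smul_right] at h1
  rw [geodesicCurvature, hvel, hv.cross_normal_fst]
  linarith

end Manifold

/-! ### Existence of curvature lines. -/

/-- An integral curve of a `C¹` vector field is of class `C²`. -/
theorem contDiffOn_two_of_hasDerivAt {E : Type*} [NormedAddCommGroup E] [NormedSpace ℝ E]
    {X : E → E} {α : ℝ → E} {s : Set ℝ} (hs : IsOpen s) (hα : ∀ t ∈ s, HasDerivAt α (X (α t)) t)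
    (hX : ∀ t ∈ s, ContDiffAt ℝ 1 X (α t)) : ContDiffOn ℝ 2 α s := by
  have hd : DifferentiableOn ℝ α s := fun t ht => (hα t ht).differentiableAt.differentiableWithinAt
  have hcongr : ∀ t ∈ s, deriv α t = X (α t) := fun t ht => (hα t ht).deriv
  have h1 : ContDiffOn ℝ 1 α s := by
    rw [show (1 : WithTop ℕ∞) = 0 + 1 by norm_num, contDiffOn_succ_iff_deriv_of_isOpen hs]
    refine ⟨hd, by simp, contDiffOn_zero.2 (ContinuousOn.congr (fun t ht => ?_) hcongr)⟩
    exact ((hX t ht).continuousAt.comp (hα t ht).continuousAt).continuousWithinAt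
  rw [show (2 : WithTop ℕ∞) = 1 + 1 by norm_num, contDiffOn_succ_iff_deriv_of_isOpen hs]
  exact ⟨hd, by simp, ContDiffOn.congr
    (fun t ht => (hX t ht).comp_contDiffWithinAt t (h1 t ht)) hcongr⟩

variable [IsManifold (𝓡 2) ∞ M]

/-- Through a non-umbilical point there is a curvature line in every principal direction. -/
theorem exists_curvatureLine {κ₁ κ₂ : M → ℝ} (hκ : surf.ArePrincipalCurvatures κ₁ κ₂) {p : M}
    (hp : ¬ surf.IsUmbilical p) {v : surf.tangentPlane p} (hv : surf.shapeOperator p v = κ₁ p • v)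
    (hv1 : ‖v‖ = 1) :
    ∃ (γ : ℝ → M) (ε : ℝ), 0 < ε ∧ surf.IsCurvatureLineOn γ (-ε) ε ∧ γ 0 = p ∧
      surf.velocity γ 0 = v := by
  have hne : κ₁ p - κ₂ p ≠ 0 := sub_ne_zero.2 fun h => hp (hκ.isUmbilical h)
  -- Scaled so that the principal field built from w equals v at p, with the correct sign.
  let w : surf.tangentPlane p := (κ₁ p - κ₂ p)⁻¹ • v
  have hw : surf.shapeOperator p w = κ₁ p • w := by rw [map_smul, hv, smul_comm]
  let W : EuclideanSpace ℝ (Fin 2) → E3 := surf.principalField κ₂ w ∘ param p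
  let V : EuclideanSpace ℝ (Fin 2) → E3 := fun x => ‖W x‖⁻¹ • W x
  -- The unit principal field pulled back to the chart; its integral curves map to unit-speed curves
  -- on the surface.
  let X : EuclideanSpace ℝ (Fin 2) → EuclideanSpace ℝ (Fin 2) := fun x =>
    ((surf.frameMap p x).inverse (V x)).1
  set x₀ := extChartAt (𝓡 2) p p with hx₀def
  have hx₀ : x₀ ∈ paramDomain p := mem_extChartAt_target p
  have hW : ContDiffAt ℝ ∞ W x₀ :=
    contDiffAt_comp_param (surf.contMDiffAt_principalField (hκ.symm.contMDiffAt hp) w)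
  have hWx₀ : W x₀ = v := by
    change surf.principalField κ₂ w (param p x₀) = v
    rw [hx₀def, param_extChartAt, surf.principalField_self hw, Submodule.coe_smul, smul_smul,
      mul_inv_cancel₀ hne, one_smul]
  have hvn : ‖(v : E3)‖ = 1 := hv1
  have hW0 : W x₀ ≠ 0 := by
    rw [hWx₀, ← norm_ne_zero_iff, hvn]
    exact one_ne_zero
  have hV : ContDiffAt ℝ ∞ V x₀ := ((hW.norm ℝ hW0).inv (norm_ne_zero_iff.2 hW0)).smul hW
  have hX : ContDiffAt ℝ 1 X x₀ := by
    have h1 := ((surf.contDiffOn_frameMap_inverse p).contDiffAt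
      ((isOpen_paramDomain p).mem_nhds hx₀)).clm_apply hV
    exact (contDiff_fst.contDiffAt.comp x₀ h1).of_le (by norm_cast)
  have hVmem : ∀ x, V x ∈ surf.tangentPlane (param p x) := fun x =>
    Submodule.smul_mem _ _ (surf.principalField_mem κ₂ w _)
  obtain ⟨α, hα0, ε, hε, hα⟩ :=
    hX.exists_forall_mem_closedBall_exists_eq_forall_mem_Ioo_hasDerivAt₀ 0
  have hgood : ∀ᶠ x in 𝓝 x₀, x ∈ paramDomain p ∧ W x ≠ 0 ∧ ContDiffAt ℝ 1 X x :=
    ((isOpen_paramDomain p).eventually_mem hx₀).and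
      ((hW.continuousAt.eventually_ne hW0).and (hX.eventually (by simp)))
  have hαc : ContinuousAt α 0 := (hα 0 ⟨by linarith, by linarith⟩).continuousAt
  have hev : ∀ᶠ t in 𝓝 (0 : ℝ), α t ∈ paramDomain p ∧ W (α t) ≠ 0 ∧ ContDiffAt ℝ 1 X (α t) :=
    hαc.eventually (by rwa [hα0])
  -- ε comes from Picard–Lindelöf; δ keeps the solution inside the chart, where W ≠ 0 and X is C¹.
  obtain ⟨δ, hδ, hball⟩ := Metric.eventually_nhds_iff.1 hev
  have hsub : ∀ t ∈ Set.Ioo (-min ε δ) (min ε δ), HasDerivAt α (X (α t)) t ∧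
      α t ∈ paramDomain p ∧ W (α t) ≠ 0 ∧ ContDiffAt ℝ 1 X (α t) := by
    intro t ht
    have h1 := min_le_left ε δ
    have h2 := min_le_right ε δ
    refine ⟨hα t ⟨by linarith [ht.1], by linarith [ht.2]⟩, hball ?_⟩
    rw [Real.dist_eq, sub_zero, abs_lt]
    exact ⟨by linarith [ht.1], by linarith [ht.2]⟩
  have hvel : ∀ t ∈ Set.Ioo (-min ε δ) (min ε δ), surf.velocity (param p ∘ α) t = V (α t) := by
    intro t ht
    obtain ⟨h1, h2, -, -⟩ := hsub t ht
    have hF : DifferentiableAt ℝ (surf.toFun ∘ param p) (α t) :=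
      ((contDiffOn_comp_param surf.smooth_toFun p).contDiffAt
        ((isOpen_paramDomain p).mem_nhds h2)).differentiableAt (by simp)
    exact (hF.hasFDerivAt.comp_hasDerivAt t h1).deriv.trans
      (surf.fderiv_frameMap_inverse h2 (hVmem _))
  have hpos : 0 < min ε δ := lt_min hε hδ
  refine ⟨param p ∘ α, min ε δ, hpos, ⟨?_, ?_, ?_⟩, ?_, ?_⟩
  · refine ((contMDiffOn_param p).of_le (by norm_cast)).comp
      (contDiffOn_two_of_hasDerivAt isOpen_Ioo (fun t ht => (hsub t ht).1)
        fun t ht => (hsub t ht).2.2.2).contMDiffOn fun t ht => (hsub t ht).2.1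
  · intro t ht
    rw [hvel t ht, norm_smul, norm_inv, norm_norm,
      inv_mul_cancel₀ (norm_ne_zero_iff.2 (hsub t ht).2.2.1)]
  · intro t ht
    refine ⟨⟨V (α t), hVmem _⟩, (hvel t ht).symm, κ₁ (param p (α t)), Subtype.ext ?_⟩
    change ((surf.shapeOperator (param p (α t)) ⟨V (α t), hVmem _⟩ : surf.tangentPlane _) : E3)
      = κ₁ (param p (α t)) • V (α t)
    rw [← extendEnd_coe]
    change surf.extShape (param p (α t)) (‖W (α t)‖⁻¹ • W (α t)) = _
    rw [map_smul, smul_comm]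
    congr 1
    exact surf.extShape_principalField hκ w _
  · rw [Function.comp_apply, hα0, hx₀def, param_extChartAt]
  · rw [hvel 0 ⟨by linarith, hpos⟩, hα0]
    change ‖W x₀‖⁻¹ • W x₀ = v
    rw [hWx₀, hvn, inv_one, one_smul]

end OrientedImmersedSurface

end

theorem mainTheorem6 {M : Type*} [TopologicalSpace M] [T2Space M] [CompactSpace M]
    [ChartedSpace (EuclideanSpace ℝ (Fin 2)) M] [IsManifold (𝓡 2) ∞ M]
    (surf : OrientedImmersedSurface M) (κ₁ κ₂ : M → ℝ) (hκ : surf.ArePrincipalCurvatures κ₁ κ₂)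
    (p : M) (hp : ¬ surf.IsUmbilical p) (v₁ v₂ : surf.tangentPlane p)
    (hv : surf.IsDarbouxFrame κ₁ κ₂ p v₁ v₂) :
    MDifferentiableAt (𝓡 2) 𝓘(ℝ, ℝ) κ₁ p ∧
    (∃ (γ : ℝ → M) (ε : ℝ), 0 < ε ∧ surf.IsCurvatureLineOn γ (-ε) ε ∧ γ 0 = p ∧
      surf.velocity γ 0 = v₁) ∧
    ∀ (γ : ℝ → M) (ε : ℝ), 0 < ε → surf.IsCurvatureLineOn γ (-ε) ε → γ 0 = p →
      surf.velocity γ 0 = v₁ →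
      surf.geodesicCurvature γ 0 = surf.dirDeriv κ₁ p v₂ / (κ₁ p - κ₂ p) ∧
      |surf.geodesicCurvature γ 0| ≤ surf.shapeDerivBound / |κ₁ p - κ₂ p| := by
  have hne : κ₁ p - κ₂ p ≠ 0 := sub_ne_zero.2 fun h => hp (hκ.isUmbilical h)
  refine ⟨(hκ.contMDiffAt hp).mdifferentiableAt (by simp),
    surf.exists_curvatureLine hκ hp hv.shape_fst hv.norm_fst, ?_⟩
  rintro γ ε hε hγ rfl hvel
  have hd := surf.dirDeriv_principalCurvature hκ hp hv.shape_fst hv.inner_fst_fst v₂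
  have hg : surf.geodesicCurvature γ 0
      = surf.dirDeriv κ₁ (γ 0) v₂ / (κ₁ (γ 0) - κ₂ (γ 0)) := by
    -- ⟨(D_{v₁} B) v₁, v₂⟩ = ⟨v₁, (D_{v₁} B) v₂⟩ = ⟨v₁, (D_{v₂} B) v₁⟩ = dκ₁(v₂): self-adjointness,
    -- Codazzi, derivative of κ₁.
    rw [eq_div_iff hne, mul_comm, surf.geodesicCurvature_mul ⟨neg_lt_zero.2 hε, hε⟩ hγ hv hvel,
      surf.dirDeriv_extShape_inner, surf.dirDeriv_extShape_symm, real_inner_comm, hd]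
  refine ⟨hg, ?_⟩
  rw [hg, abs_div, hd]
  gcongr
  exact (surf.inner_dirDeriv_extShape_le v₂ v₁ hv.inner_fst_fst).trans
    (surf.norm_covDerivEnd_le_shapeDerivBound hv.norm_snd)
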